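/- Let $0<a<c$ be integers, let $z$ be in the upper half-plane, and put $q:=e^{2\pi i z}$, $q^{r}:=e^{2\pi i r z}$ for $r\in\mathbb{R}$, $\zeta_c^{r}:=e^{2\pi i r/c}$. For complex $x$ and $p$ with $0<|p|<1$ let $$(x;p)_n:=\prod_{i=0}^{n-1}(1-p^i x),\qquad (x;p)_\infty:=\prod_{i\ge 0}(1-p^i x),\qquad j(x;p):=(x;p)_\infty(p/x;p)_\infty(p;p)_\infty\quad (x\neq 0),$$ and let $J_{b,m}:=j(q^b;q^m)$, $J_m:=J_{m,3m}$. Define $$K'(\omega;z):=\sum_{n\ge 0}\frac{(-1)^nq^{n^2}(q;q^2)_n}{(\omega q^2;q^2)_n(\omega^{-1}q^2;q^2)_n},\qquad K''(\omega;z):=\sum_{n\ge 1}\frac{(-1)^nq^{n^2}(q;q^2)_{n-1}}{(\omega q;q^2)_n(\omega^{-1}q;q^2)_n},$$ $$H'(a,c,\omega;z):=\sum_{n\ge 0}\frac{q^{n(n+1)/2}(-q;q)_n}{(\omega q^{a/c};q)_{n+1}(\omega q^{1-a/c};q)_{n+1}},$$ $$\tilde K(a,c;z):=\tfrac14\csc\!\left(\pi\tfrac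 ac\right)q^{-1/8}K'(\zeta_c^a;z)+\sin\!\left(\pi\tfrac ac\right)q^{-1/8}K''(\zeta_c^a;z),$$ $$\tilde H(a,c;z):=q^{\frac ac(1-\frac ac)}\bigl(H'(a,c,1;z)+H'(a,c,-1;z)\bigr).$$ Then the series $K'(\zeta_c^a;z)$, $K''(\zeta_c^a;z)$, $H'(a,c,\pm1;z)$ converge absolutely, the theta functions $J_{1,2}$, $j(q^{2a/c};q^2)$, $j(\zeta_c^a;q)$ are nonzero, and $$\tilde H(a,c;z)=2q^{\frac ac(1-\frac ac)}\frac{J_2^3}{J_{1,2}\,j(q^{2a/c};q^2)},\qquad \tilde K(a,c;z)=-\frac{i\,\zeta_c^{a/2}q^{-1/8}}{2}\,\frac{J_{1,2}^2}{j(\zeta_c^a;q)}.$$ -/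

import Mathlib

open Complex

noncomputable section

namespace EulerianSeries

/-- The finite `q`-Pochhammer symbol `(x; q)_n = ∏_{i=0}^{n-1} (1 - q^i x)`. -/
def qPoch (x q : ℂ) (n : ℕ) : ℂ := ∏ i ∈ Finset.range n, (1 - q ^ i * x)

/-- The infinite `q`-Pochhammer symbol `(x; q)_∞ = ∏_{i ≥ 0} (1 - q^i x)`
(the product converges for `|q| < 1`, see `multipliable_qPochInf`). -/
def qPochInf (x q : ℂ) : ℂ := ∏' i : ℕ, (1 - q ^ i * x)

theorem multipliable_qPochInf (x : ℂ) {q : ℂ} (hq : ‖q‖ < 1) :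
    Multipliable fun i : ℕ => (1 - q ^ i * x) := by
  have h : Summable fun i : ℕ => ‖-(q ^ i * x)‖ := by
    simpa [norm_mul, norm_pow] using
      (summable_geometric_of_lt_one (norm_nonneg q) hq).mul_right ‖x‖
  simpa [sub_eq_add_neg] using multipliable_one_add_of_summable h

/-- The theta function `j(x; q) = (x; q)_∞ (q/x; q)_∞ (q; q)_∞`. -/
def thetaJ (x q : ℂ) : ℂ := qPochInf x q * qPochInf (q / x) q * qPochInf q q

/-- `J_{a,m} = j(q^a; q^m)`. -/
def thetaJam (a : ℤ) (m : ℕ) (q : ℂ) : ℂ := thetaJ (q ^ a) (q ^ m)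

/-- `J_m = J_{m,3m}`. -/
def thetaJm (m : ℕ) (q : ℂ) : ℂ := thetaJam m (3 * m) q

/-- `q^r = e^{2 π i r z}`, where `q = e^{2 π i z}`; here `r` may be fractional. -/
def qPow (z : UpperHalfPlane) (r : ℝ) : ℂ := exp (2 * Real.pi * I * r * z)

/-- `q = e^{2 π i z}`. -/
def nome (z : UpperHalfPlane) : ℂ := exp (2 * Real.pi * I * z)

/-- `ζ_c^r = e^{2 π i r / c}`, where `ζ_c = e^{2 π i / c}`; here `r` may be fractional. -/
def zetaPow (c : ℕ) (r : ℝ) : ℂ := exp (2 * Real.pi * I * r / c)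

/-- The `n`-th term of the series `K'(ω; z)`. -/
def KPrimeTerm (ω : ℂ) (z : UpperHalfPlane) (n : ℕ) : ℂ :=
  (-1) ^ n * nome z ^ (n ^ 2) * qPoch (nome z) (nome z ^ 2) n /
    (qPoch (ω * nome z ^ 2) (nome z ^ 2) n * qPoch (ω⁻¹ * nome z ^ 2) (nome z ^ 2) n)

/-- `K'(ω; z) = ∑_{n ≥ 0} (-1)^n q^{n^2} (q; q^2)_n / ((ω q^2; q^2)_n (ω⁻¹ q^2; q^2)_n)`. -/
def KPrime (ω : ℂ) (z : UpperHalfPlane) : ℂ := ∑' n : ℕ, KPrimeTerm ω z n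

/-- The `n`-th term of the series `K''(ω; z)`, used for `n ≥ 1` only. -/
def KDoublePrimeTerm (ω : ℂ) (z : UpperHalfPlane) (n : ℕ) : ℂ :=
  (-1) ^ n * nome z ^ (n ^ 2) * qPoch (nome z) (nome z ^ 2) (n - 1) /
    (qPoch (ω * nome z) (nome z ^ 2) n * qPoch (ω⁻¹ * nome z) (nome z ^ 2) n)

/-- `K''(ω; z) = ∑_{n ≥ 1} (-1)^n q^{n^2} (q; q^2)_{n-1} / ((ω q; q^2)_n (ω⁻¹ q; q^2)_n)`;
the summation index is shifted by one, so that it starts at `0`. -/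
def KDoublePrime (ω : ℂ) (z : UpperHalfPlane) : ℂ := ∑' n : ℕ, KDoublePrimeTerm ω z (n + 1)

/-- The `n`-th term of the series `H'(a, c, ω; z)`. -/
def HPrimeTerm (a c : ℕ) (ω : ℂ) (z : UpperHalfPlane) (n : ℕ) : ℂ :=
  nome z ^ (n * (n + 1) / 2) * qPoch (-nome z) (nome z) n /
    (qPoch (ω * qPow z (a / c)) (nome z) (n + 1) *
      qPoch (ω * qPow z (1 - a / c)) (nome z) (n + 1))

/-- `H'(a, c, ω; z) =
∑_{n ≥ 0} q^{n(n+1)/2} (-q; q)_n / ((ω q^{a/c}; q)_{n+1} (ω q^{1-a/c}; q)_{n+1})`. -/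
def HPrime (a c : ℕ) (ω : ℂ) (z : UpperHalfPlane) : ℂ := ∑' n : ℕ, HPrimeTerm a c ω z n

/-- `K̃(a, c; z) = (1/4) csc(π a/c) q^{-1/8} K'(ζ_c^a; z) + sin(π a/c) q^{-1/8} K''(ζ_c^a; z)`. -/
def KTilde (a c : ℕ) (z : UpperHalfPlane) : ℂ :=
  1 / 4 * (1 / (Real.sin (Real.pi * (a / c)) : ℂ)) * qPow z (-1 / 8) * KPrime (zetaPow c a) z +
    (Real.sin (Real.pi * (a / c)) : ℂ) * qPow z (-1 / 8) * KDoublePrime (zetaPow c a) z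

/-- `H̃(a, c; z) = q^{(a/c)(1-a/c)} (H'(a, c, 1; z) + H'(a, c, -1; z))`. -/
def HTilde (a c : ℕ) (z : UpperHalfPlane) : ℂ :=
  qPow z (a / c * (1 - a / c)) * (HPrime a c 1 z + HPrime a c (-1) z)

end EulerianSeries

end

noncomputable section

namespace EulerianSeries

open Filter Topology

/-! Everything is reduced to the bilateral sum `∑ (-1)^k q^(k(k+1)/2) / (1 - x q^k) = (q;q)_∞^3 /
j(x;q)` (`hasSum_lerchTerm`), the limit of a finite partial fraction expansion of `1 / ((x;q)_{N+1}
(q/x;q)_M)` (`hasSum_partialFraction`).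

Each Eulerian series is a weighted sum over `n` of such finite products. Inserting the expansion and
exchanging the sums (`hasSum_lerchTerm_mul`) leaves, for each `k`, a sum over `n` that a `₁φ₁`
summation evaluates in closed form (`hasSum_conjugateBailey`).

For `H'` this gives a constant times `∑ (-1)^k q^(k(k+1)) / (1 - x q^k)`. Adding the series at `x`
and `-x` turns the denominators into `1 - x^2 q^(2k)`, which is the basic sum in base `q^2`
(`mockTheta_add_neg`).

For `K'` and `K''`, in base `q^2`, the results are, up to elementary factors, the even-indexed and
odd-indexed parts of the basic sum in base `q`. Together they restore the whole sum
(`KPrime_sub_KDoublePrime`), and the trigonometric coefficients of `K̃` are exactly the required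
ones. -/

theorem _root_.HasSum.of_eq {β : Type*} {f g : β → ℂ} {s t : ℂ} (h : HasSum f s)
    (hfg : ∀ k, g k = f k) (hst : s = t) : HasSum g t := by
  rwa [funext hfg, ← hst]

/-! ### Triangular numbers and finite `q`-Pochhammer symbols -/

/-- The triangular number `k (k + 1) / 2` of an integer. -/
def tri (k : ℤ) : ℤ := k * (k + 1) / 2

theorem two_mul_tri (k : ℤ) : 2 * tri k = k * (k + 1) :=
  Int.mul_ediv_cancel' (Int.even_mul_succ_self k).two_dvd

theorem tri_sub_one (k : ℤ) : tri (k - 1) = tri k - k := by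
  have h := two_mul_tri k
  have h' := two_mul_tri (k - 1)
  linarith

theorem tri_neg_sub_one (k : ℤ) : tri (-1 - k) = tri k := by
  have h := two_mul_tri k
  have h' := two_mul_tri (-1 - k)
  linarith

theorem tri_natCast (n : ℕ) : tri n = ((n + 1).choose 2 : ℕ) := by
  have h := two_mul_tri n
  have h2 := Nat.triangle_succ n
  rw [Nat.choose_two_right, tri]
  push_cast
  simp [mul_comm]

theorem qPoch_zero (x q : ℂ) : qPoch x q 0 = 1 := by simp [qPoch]

theorem qPoch_succ (x q : ℂ) (n : ℕ) : qPoch x q (n + 1) = qPoch x q n * (1 - q ^ n * x) :=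
  Finset.prod_range_succ _ _

theorem qPoch_add (x q : ℂ) (m n : ℕ) :
    qPoch x q (m + n) = qPoch x q m * qPoch (q ^ m * x) q n := by
  simp only [qPoch, Finset.prod_range_add]
  congr 1
  exact Finset.prod_congr rfl fun i _ => by ring

theorem one_sub_pow_mul_ne_zero {x q : ℂ} (hq : ‖q‖ ≤ 1) (hx : ‖x‖ < 1) (i : ℕ) :
    1 - q ^ i * x ≠ 0 := by
  intro h
  have h1 : ‖q ^ i * x‖ = 1 := by rw [← sub_eq_zero.mp h, norm_one]
  rw [norm_mul, norm_pow] at h1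
  have h2 : ‖q‖ ^ i ≤ 1 := pow_le_one₀ (norm_nonneg _) hq
  nlinarith [norm_nonneg x]

theorem qPoch_ne_zero {x q : ℂ} (h : ∀ i : ℕ, 1 - q ^ i * x ≠ 0) (n : ℕ) : qPoch x q n ≠ 0 :=
  Finset.prod_ne_zero_iff.mpr fun i _ => h i

/-! ### Finite partial fractions -/

/-- `1 / (q; q)_m`, extended by zero to negative `m`. -/
def invPoch (q : ℂ) : ℤ → ℂ
  | Int.ofNat n => (qPoch q q n)⁻¹
  | Int.negSucc _ => 0

theorem invPoch_natCast (q : ℂ) (n : ℕ) : invPoch q n = (qPoch q q n)⁻¹ := rfl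

theorem invPoch_of_neg (q : ℂ) {m : ℤ} (hm : m < 0) : invPoch q m = 0 := by
  obtain ⟨n, rfl⟩ := Int.eq_negSucc_of_lt_zero hm
  rfl

/-- The factor `1 - q^0 = 0` makes the extension by zero consistent, so the recurrences for
bilateral sums below need no boundary terms. -/
theorem invPoch_mul {q : ℂ} (hq : ‖q‖ < 1) (m : ℤ) :
    invPoch q m * (1 - q ^ m) = invPoch q (m - 1) := by
  rcases lt_trichotomy m 0 with h | rfl | h
  · rw [invPoch_of_neg q h, invPoch_of_neg q (by omega), zero_mul]
  · rw [invPoch_of_neg q (by omega : (0 : ℤ) - 1 < 0)]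
    simp
  · obtain ⟨n, rfl⟩ : ∃ n : ℕ, m = (n + 1 : ℕ) := ⟨(m - 1).toNat, by omega⟩
    have h1 := one_sub_pow_mul_ne_zero hq.le hq n
    have h2 := qPoch_ne_zero (one_sub_pow_mul_ne_zero hq.le hq) n
    rw [show ((n + 1 : ℕ) : ℤ) - 1 = (n : ℕ) by push_cast; ring, invPoch_natCast,
      invPoch_natCast, qPoch_succ, zpow_natCast, pow_succ]
    field_simp

theorem summable_invPoch_mul (q : ℂ) (N M : ℤ) (f : ℤ → ℂ) :
    Summable fun k : ℤ => f k * (invPoch q (N - k) * invPoch q (M + k)) := by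
  refine summable_of_hasFiniteSupport ((Set.finite_Icc (-M) N).subset fun k hk => ?_)
  by_contra h
  rw [Set.mem_Icc, not_and_or, not_le, not_le] at h
  apply hk
  rcases h with h | h
  · simp [invPoch_of_neg q (by omega : M + k < 0)]
  · simp [invPoch_of_neg q (by omega : N - k < 0)]

theorem one_sub_pow_ne_zero {q : ℂ} (hq : ‖q‖ < 1) {n : ℕ} (hn : n ≠ 0) : 1 - q ^ n ≠ 0 := by
  obtain ⟨m, rfl⟩ := Nat.exists_eq_succ_of_ne_zero hn
  have := one_sub_pow_mul_ne_zero hq.le hq m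
  rwa [← pow_succ] at this

/-- An alternating `q`-binomial sum that vanishes. -/
theorem hasSum_alternating_invPoch {q : ℂ} (hq0 : q ≠ 0) (hq : ‖q‖ < 1) (N M : ℕ) :
    HasSum (fun k : ℤ => (-1) ^ k * q ^ tri (k - 1) *
      (invPoch q ((N + 1 : ℕ) - k) * invPoch q (M + k))) 0 := by
  -- The split `1 - q^(N+1+M) = (1 - q^(N+1-k)) + q^(N+1-k) (1 - q^(M+k))` lowers one index in each
  -- part; the second part is `-q^N` times the sum for `N`, shifted by one in `k`.
  have step : ∀ N : ℕ, ∀ s t : ℂ,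
      HasSum (fun k : ℤ => (-1) ^ k * q ^ tri (k - 1) *
        (invPoch q (N - k) * invPoch q (M + k))) t →
      HasSum (fun k : ℤ => (-1) ^ k * q ^ tri (k - 1) *
        (invPoch q ((N + 1 : ℕ) - k) * invPoch q (M + k))) s →
      (1 - q ^ (N + 1 + M)) * s = (1 - q ^ N) * t := by
    intro N s t ht hs
    have h2 : HasSum (fun k : ℤ => -q ^ N * ((-1) ^ k * q ^ tri (k - 1) *
        (invPoch q (N - k) * invPoch q (M + k)))) (-q ^ N * t) := ht.mul_left _
    rw [← (Equiv.subRight (1 : ℤ)).hasSum_iff] at h2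
    have h3 := ht.add h2
    have h4 := hs.mul_left (1 - q ^ (N + 1 + M))
    rw [show (1 - q ^ N) * t = t + -q ^ N * t by ring]
    refine h4.unique (h3.of_eq (fun k => ?_) rfl)
    have e1 := invPoch_mul hq ((N + 1 : ℕ) - k)
    have e2 := invPoch_mul hq (M + k)
    rw [show ((N + 1 : ℕ) : ℤ) - k - 1 = N - k by push_cast; ring] at e1
    rw [Function.comp_apply, Equiv.subRight_apply, show (N : ℤ) - (k - 1) = (N + 1 : ℕ) - k by
      push_cast; ring, show (M : ℤ) + (k - 1) = M + k - 1 by ring, ← e1, ← e2, tri_sub_one (k - 1),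
      zpow_sub₀ hq0, zpow_sub₀ hq0, zpow_sub₀ (by norm_num : (-1 : ℂ) ≠ 0), zpow_sub₀ hq0,
      zpow_add₀ hq0]
    simp only [zpow_natCast, zpow_one]
    have hk : q ^ k ≠ 0 := zpow_ne_zero _ hq0
    field_simp
    ring
  have summ := fun N : ℕ => summable_invPoch_mul q N M (fun k => (-1) ^ k * q ^ tri (k - 1))
  induction N with
  | zero =>
    -- The factor `1 - q^0` starts the induction, although the sum with top index `0` need not
    -- vanish.
    have h := step 0 _ _ (summ 0).hasSum (summ 1).hasSum
    rw [pow_zero, sub_self, zero_mul] at h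
    have h0 := (mul_eq_zero.mp h).resolve_left (one_sub_pow_ne_zero hq (by omega))
    rw [← h0]
    exact (summ 1).hasSum
  | succ N ih =>
    have h := step (N + 1) _ _ ih (summ (N + 1 + 1)).hasSum
    rw [mul_zero] at h
    have h0 := (mul_eq_zero.mp h).resolve_left (one_sub_pow_ne_zero hq (by omega))
    rw [← h0]
    exact (summ (N + 1 + 1)).hasSum

theorem one_sub_pow_mul_ne_zero_of_zpow {q x : ℂ} (hx : ∀ k : ℤ, 1 - x * q ^ k ≠ 0) (n : ℕ) :
    1 - q ^ n * x ≠ 0 := by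
  simpa [mul_comm] using hx n

theorem one_sub_pow_mul_div_ne_zero_of_zpow {q : ℂ} (hq0 : q ≠ 0) {x : ℂ} (hx0 : x ≠ 0)
    (hx : ∀ k : ℤ, 1 - x * q ^ k ≠ 0) (n : ℕ) : 1 - q ^ n * (q / x) ≠ 0 := fun h => by
  refine hx (-(n + 1 : ℕ)) ?_
  rw [zpow_neg, zpow_natCast, pow_succ]
  field_simp at h ⊢
  linear_combination -h

/-- The partial fraction decomposition of `1 / ((x; q)_{N+1} (q/x; q)_M)`. -/
theorem hasSum_partialFraction {q : ℂ} (hq0 : q ≠ 0) (hq : ‖q‖ < 1) {x : ℂ} (hx0 : x ≠ 0)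
    (hx : ∀ k : ℤ, 1 - x * q ^ k ≠ 0) (N M : ℕ) :
    HasSum (fun k : ℤ => (-1) ^ k * q ^ tri k / (1 - x * q ^ k) *
      (invPoch q (N - k) * invPoch q (M + k)))
      (1 / (qPoch x q (N + 1) * qPoch (q / x) q M)) := by
  have summ := fun N M : ℕ => summable_invPoch_mul q N M
    (fun k => (-1) ^ k * q ^ tri k / (1 - x * q ^ k))
  have hNk : ∀ k : ℤ, q ^ k ≠ 0 := fun k => zpow_ne_zero k hq0
  have hxn := one_sub_pow_mul_ne_zero_of_zpow hx
  have hxn' := one_sub_pow_mul_div_ne_zero_of_zpow hq0 hx0 hx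
  induction M with
  | zero =>
    induction N with
    | zero =>
      convert hasSum_single (0 : ℤ) ?_ using 1
      · simp [qPoch, tri,
          show invPoch q 0 = 1 by simpa [qPoch] using invPoch_natCast q 0]
      · intro k hk
        rcases lt_or_gt_of_ne hk with h | h
        · simp [invPoch_of_neg q h]
        · simp [invPoch_of_neg q (by omega : -k < 0)]
    | succ N ih =>
      have h1 := (summ (N + 1) 0).hasSum
      have h2 := (hasSum_alternating_invPoch hq0 hq N 0).mul_left (q ^ (N + 1))
      have h3 := ih.add h2
      -- Here `1 - q^(N+1) x = (1 - q^(N+1-k)) + q^(N+1-k) (1 - x q^k)`: the first part lowers `N`,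
      -- the second cancels the pole and leaves the vanishing alternating sum.
      have h4 := (h1.mul_left (1 - q ^ (N + 1) * x)).unique (h3.of_eq (fun k => by
        have e1 := invPoch_mul hq ((N + 1 : ℕ) - k)
        rw [show ((N + 1 : ℕ) : ℤ) - k - 1 = N - k by push_cast; ring] at e1
        rw [← e1, tri_sub_one, zpow_sub₀ hq0, zpow_sub₀ hq0, zpow_natCast]
        have := hNk k
        have := hx k
        field_simp
        ring) rfl)
      refine h1.of_eq (fun _ => rfl) ?_
      rw [mul_zero, add_zero] at h4
      rw [qPoch_succ, ← mul_right_inj' (hxn (N + 1)), h4]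
      have := hxn (N + 1)
      have := qPoch_ne_zero hxn (N + 1)
      simp only [qPoch_zero]
      field_simp
  | succ M ih =>
    have h1 := (summ N (M + 1)).hasSum
    have h2 := ((Equiv.addRight (1 : ℤ)).hasSum_iff.mpr
      (hasSum_alternating_invPoch hq0 hq N M)).mul_left (q ^ (M + 1) / x)
    have h3 := ih.add h2
    -- Likewise `1 - q^(M+1)/x = (1 - q^(M+1+k)) - (q^(M+1)/x) (1 - x q^k)`.
    have h4 := (h1.mul_left (1 - q ^ M * (q / x))).unique (h3.of_eq (fun k => by
      have e1 := invPoch_mul hq ((M + 1 : ℕ) + k)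
      rw [show ((M + 1 : ℕ) : ℤ) + k - 1 = M + k by push_cast; ring] at e1
      rw [← e1, Function.comp_apply, Equiv.coe_addRight, add_sub_cancel_right,
        show ((N + 1 : ℕ) : ℤ) - (k + 1) = N - k by push_cast; ring,
        show (M : ℤ) + (k + 1) = (M + 1 : ℕ) + k by push_cast; ring, zpow_add₀ hq0 _ k,
        zpow_natCast, zpow_add₀ (by norm_num : (-1 : ℂ) ≠ 0)]
      have := hx k
      field_simp
      ring) rfl)
    refine h1.of_eq (fun _ => rfl) ?_
    rw [mul_zero, add_zero] at h4
    rw [qPoch_succ _ _ M, ← mul_right_inj' (hxn' M), h4]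
    have := hxn' M
    have := qPoch_ne_zero hxn (N + 1)
    have := qPoch_ne_zero hxn' M
    set u := 1 - q ^ M * (q / x)
    field_simp

/-! ### Infinite products and the expansion of `1 / j(x;q)` -/

theorem tendsto_qPoch (x : ℂ) {q : ℂ} (hq : ‖q‖ < 1) :
    Tendsto (qPoch x q) atTop (𝓝 (qPochInf x q)) :=
  (multipliable_qPochInf x hq).hasProd.tendsto_prod_nat

theorem qPochInf_ne_zero {x q : ℂ} (hq : ‖q‖ < 1) (h : ∀ i : ℕ, 1 - q ^ i * x ≠ 0) :
    qPochInf x q ≠ 0 := by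
  have hs : Summable fun i : ℕ => ‖-(q ^ i * x)‖ := by
    simpa [norm_mul, norm_pow] using
      (summable_geometric_of_lt_one (norm_nonneg q) hq).mul_right ‖x‖
  have := tprod_one_add_ne_zero_of_summable (f := fun i : ℕ => -(q ^ i * x))
    (fun i => by simpa [sub_eq_add_neg] using h i) hs
  simpa [qPochInf, sub_eq_add_neg] using this

theorem exists_norm_le_of_tendsto {f : ℕ → ℂ} {l : ℂ} (h : Tendsto f atTop (𝓝 l)) :
    ∃ B, 0 ≤ B ∧ ∀ n, ‖f n‖ ≤ B := by
  obtain ⟨B, hB⟩ := h.norm.bddAbove_range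
  exact ⟨B, (norm_nonneg _).trans (hB ⟨0, rfl⟩), fun n => hB ⟨n, rfl⟩⟩

theorem exists_norm_qPoch_le (x : ℂ) {q : ℂ} (hq : ‖q‖ < 1) :
    ∃ B, 0 ≤ B ∧ ∀ n, ‖qPoch x q n‖ ≤ B :=
  exists_norm_le_of_tendsto (tendsto_qPoch x hq)

theorem exists_norm_inv_qPoch_le {x q : ℂ} (hq : ‖q‖ < 1) (h : ∀ i : ℕ, 1 - q ^ i * x ≠ 0) :
    ∃ B, 0 ≤ B ∧ ∀ n, ‖(qPoch x q n)⁻¹‖ ≤ B :=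
  exists_norm_le_of_tendsto ((tendsto_qPoch x hq).inv₀ (qPochInf_ne_zero hq h))

theorem exists_norm_invPoch_le {q : ℂ} (hq : ‖q‖ < 1) :
    ∃ B, 0 ≤ B ∧ ∀ m, ‖invPoch q m‖ ≤ B := by
  obtain ⟨B, hB0, hB⟩ := exists_norm_inv_qPoch_le hq (one_sub_pow_mul_ne_zero hq.le hq)
  refine ⟨B, hB0, fun m => ?_⟩
  cases m with
  | ofNat n => exact hB n
  | negSucc n => simpa [invPoch] using hB0

theorem qPochInf_eq_mul (x : ℂ) {q : ℂ} (hq : ‖q‖ < 1) (k : ℕ) :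
    qPochInf x q = qPoch x q k * qPochInf (q ^ k * x) q := by
  refine tendsto_nhds_unique ((tendsto_add_atTop_iff_nat k).mpr (tendsto_qPoch x hq)) ?_
  refine ((tendsto_qPoch (q ^ k * x) hq).const_mul (qPoch x q k)).congr fun n => ?_
  rw [add_comm n k, qPoch_add]

/-- Convergence of sums with Gaussian decay. -/
theorem summable_pow_choose_two {q : ℂ} (hq : ‖q‖ < 1) (t : ℂ) :
    Summable fun n : ℕ => ‖q ^ n.choose 2 * t ^ n‖ := by
  refine summable_of_ratio_norm_eventually_le (r := 1 / 2) (by norm_num) ?_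
  have h : Tendsto (fun n : ℕ => ‖q ^ n * t‖) atTop (𝓝 0) := by
    simpa using ((tendsto_pow_atTop_nhds_zero_of_norm_lt_one hq).mul_const t).norm
  filter_upwards [h.eventually_le_const (by norm_num : (0 : ℝ) < 1 / 2)] with n hn
  rw [norm_norm, norm_norm, Nat.choose_succ_succ' n 1, Nat.choose_one_right, pow_add, pow_succ t,
    show q ^ n * q ^ n.choose 2 * (t ^ n * t) = (q ^ n * t) * (q ^ n.choose 2 * t ^ n) by ring,
    norm_mul]
  exact mul_le_mul_of_nonneg_right hn (norm_nonneg _)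

/-- The Lerch-type summand `(-1)^k q^{k(k+1)/2} / (1 - x q^k)`. -/
def lerchTerm (x q : ℂ) (k : ℤ) : ℂ := (-1) ^ k * q ^ tri k / (1 - x * q ^ k)

theorem summable_lerchTerm {q : ℂ} (hq0 : q ≠ 0) (hq : ‖q‖ < 1) {x : ℂ} (hx0 : x ≠ 0) :
    Summable fun k => ‖lerchTerm x q k‖ := by
  have hpow := tendsto_pow_atTop_nhds_zero_of_norm_lt_one hq
  have key : ∀ f : ℕ → ℂ, (∃ B, 0 ≤ B ∧ ∀ n, ‖f n‖ ≤ B) →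
      Summable fun n : ℕ => ‖(q ^ (n + 1).choose 2) * f n‖ := by
    rintro f ⟨B, hB0, hB⟩
    refine Summable.of_nonneg_of_le (fun _ => norm_nonneg _) (fun n => ?_)
      ((summable_pow_choose_two hq q).mul_right B)
    rw [Nat.choose_succ_succ' n 1, Nat.choose_one_right, norm_mul, add_comm n, pow_add]
    exact mul_le_mul_of_nonneg_left (hB n) (norm_nonneg _)
  refine Summable.of_nat_of_neg_add_one ?_ ?_
  · refine (key (fun n => (1 - x * q ^ n)⁻¹) (exists_norm_le_of_tendsto (l := (1 - x * 0)⁻¹)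
      ((tendsto_const_nhds.sub (hpow.const_mul x)).inv₀ (by simp)))).congr fun n => ?_
    simp [lerchTerm, tri_natCast, div_eq_mul_inv]
  -- At `k = -1-n` the triangular number is unchanged, and clearing `q^(-n-1)` from the denominator
  -- gives a convergent factor because `x ≠ 0`.
  · refine (key (fun n => q ^ (n + 1) * (q ^ (n + 1) - x)⁻¹)
      (exists_norm_le_of_tendsto (l := 0 * (0 - x)⁻¹) ?_)).congr fun n => ?_
    · have hpow' := (tendsto_add_atTop_iff_nat 1).mpr hpow
      exact hpow'.mul ((hpow'.sub_const x).inv₀ (by simpa using hx0))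
    · have e : (q ^ (n + 1) - x)⁻¹ * q ^ (n + 1) = (1 - x * q ^ (-((n : ℤ) + 1)))⁻¹ := by
        have : q ^ (n + 1) ≠ 0 := pow_ne_zero _ hq0
        rw [show (-((n : ℤ) + 1)) = -((n + 1 : ℕ) : ℤ) by push_cast; ring, zpow_neg, zpow_natCast,
          show 1 - x * (q ^ (n + 1))⁻¹ = (q ^ (n + 1) - x) * (q ^ (n + 1))⁻¹ by field_simp,
          mul_inv, inv_inv]
      rw [lerchTerm, div_eq_mul_inv, ← e, show -((n : ℤ) + 1) = -1 - n by ring, tri_neg_sub_one,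
        tri_natCast]
      simp [mul_comm]

theorem thetaJ_ne_zero {q : ℂ} (hq0 : q ≠ 0) (hq : ‖q‖ < 1) {x : ℂ} (hx0 : x ≠ 0)
    (hx : ∀ k : ℤ, 1 - x * q ^ k ≠ 0) : thetaJ x q ≠ 0 :=
  mul_ne_zero (mul_ne_zero (qPochInf_ne_zero hq (one_sub_pow_mul_ne_zero_of_zpow hx))
    (qPochInf_ne_zero hq (one_sub_pow_mul_div_ne_zero_of_zpow hq0 hx0 hx)))
    (qPochInf_ne_zero hq (one_sub_pow_mul_ne_zero hq.le hq))

/-- The partial fraction decomposition of the reciprocal of a theta function. -/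
theorem hasSum_lerchTerm {q : ℂ} (hq0 : q ≠ 0) (hq : ‖q‖ < 1) {x : ℂ} (hx0 : x ≠ 0)
    (hx : ∀ k : ℤ, 1 - x * q ^ k ≠ 0) :
    HasSum (lerchTerm x q) (qPochInf q q ^ 3 / thetaJ x q) := by
  have hxn := one_sub_pow_mul_ne_zero_of_zpow hx
  have hxn' := one_sub_pow_mul_div_ne_zero_of_zpow hq0 hx0 hx
  have hqq := qPochInf_ne_zero hq (one_sub_pow_mul_ne_zero hq.le hq)
  have hxx := qPochInf_ne_zero hq hxn
  have hxx' := qPochInf_ne_zero hq hxn'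
  obtain ⟨B, hB0, hB⟩ := exists_norm_invPoch_le hq
  have hip : Tendsto (fun n : ℕ => invPoch q n) atTop (𝓝 (qPochInf q q)⁻¹) :=
    (tendsto_qPoch q hq).inv₀ hqq
  have hip' : ∀ k : ℤ, Tendsto (fun n : ℕ => invPoch q (n + k)) atTop (𝓝 (qPochInf q q)⁻¹) := by
    intro k
    rw [← tendsto_add_atTop_iff_nat k.natAbs]
    refine (hip.comp (tendsto_atTop_mono (fun n => ?_) tendsto_id :
      Tendsto (fun n : ℕ => (n + k.natAbs + k).toNat) atTop atTop)).congr fun n => ?_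
    · simp only [id]; omega
    · simp only [Function.comp]
      congr 1
      omega
  have hlim : Tendsto (fun n : ℕ => ∑' k : ℤ, lerchTerm x q k *
      (invPoch q (n - k) * invPoch q (n + k))) atTop
      -- The uniform bound `B` on `invPoch` gives the majorant `B^2 ‖lerchTerm x q k‖`.
      (𝓝 (∑' k : ℤ, lerchTerm x q k * ((qPochInf q q)⁻¹ * (qPochInf q q)⁻¹))) := by
    refine tendsto_tsum_of_dominated_convergence
      ((summable_lerchTerm hq0 hq hx0).mul_right (B * B)) (fun k => ?_)
      (Eventually.of_forall fun n k => ?_)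
    · exact ((hip' (-k)).mul (hip' k)).const_mul _
    · rw [norm_mul, norm_mul]
      gcongr
      exacts [hB _, hB _]
  have hlim' : Tendsto (fun n : ℕ => 1 / (qPoch x q (n + 1) * qPoch (q / x) q n)) atTop
      (𝓝 (1 / (qPochInf x q * qPochInf (q / x) q))) :=
    tendsto_const_nhds.div (((tendsto_add_atTop_iff_nat 1).mpr (tendsto_qPoch x hq)).mul
      (tendsto_qPoch _ hq)) (mul_ne_zero hxx hxx')
  have heq := tendsto_nhds_unique hlim (hlim'.congr fun n =>
    (hasSum_partialFraction hq0 hq hx0 hx n n).tsum_eq.symm)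
  rw [tsum_mul_right] at heq
  refine (summable_lerchTerm hq0 hq hx0).of_norm.hasSum.of_eq (fun _ => rfl) ?_
  rw [thetaJ]
  field_simp at heq ⊢
  linear_combination heq

/-! ### A `₁φ₁` summation and conjugate Bailey pairs -/

/-- The weight `(ρ; q)_n (-1)^n q^{n(n-1)/2} t^n` of a conjugate Bailey pair. -/
def baileyWeight (ρ t q : ℂ) (n : ℕ) : ℂ := qPoch ρ q n * ((-1) ^ n * q ^ n.choose 2 * t ^ n)

theorem add_choose_two (k m : ℕ) : (k + m).choose 2 = k.choose 2 + m.choose 2 + k * m := by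
  induction m with
  | zero => simp
  | succ m ih =>
    rw [← add_assoc, Nat.choose_succ_succ' _ 1, Nat.choose_succ_succ' m 1, ih]
    simp only [Nat.choose_one_right]
    ring

theorem baileyWeight_add (ρ t q : ℂ) (k m : ℕ) :
    baileyWeight ρ t q (k + m) =
      baileyWeight ρ t q k * baileyWeight (q ^ k * ρ) (q ^ k * t) q m := by
  simp only [baileyWeight, qPoch_add, add_choose_two]
  ring

theorem summable_baileyWeight (ρ t : ℂ) {q : ℂ} (hq : ‖q‖ < 1) :
    Summable fun n => ‖baileyWeight ρ t q n‖ := by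
  obtain ⟨B, hB0, hB⟩ := exists_norm_qPoch_le ρ hq
  refine Summable.of_nonneg_of_le (fun _ => norm_nonneg _) (fun n => ?_)
    ((summable_pow_choose_two hq t).mul_left B)
  rw [baileyWeight, norm_mul, mul_assoc, norm_mul ((-1) ^ n), norm_pow, norm_neg, norm_one,
    one_pow, one_mul]
  exact mul_le_mul_of_nonneg_right (hB n) (norm_nonneg _)

/-- The summand of the basic hypergeometric series `₁φ₁(a; a t; q, t)`. -/
def phiTerm (a t q : ℂ) (m : ℕ) : ℂ :=
  baileyWeight a t q m * ((qPoch q q m)⁻¹ * (qPoch (a * t) q m)⁻¹)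

theorem summable_phiTerm {a t q : ℂ} (hq : ‖q‖ < 1) (h : ∀ i : ℕ, 1 - q ^ i * (a * t) ≠ 0) :
    Summable (phiTerm a t q) := by
  obtain ⟨B, hB0, hB⟩ := exists_norm_inv_qPoch_le hq (one_sub_pow_mul_ne_zero hq.le hq)
  obtain ⟨C, hC0, hC⟩ := exists_norm_inv_qPoch_le hq h
  refine Summable.of_norm_bounded ((summable_baileyWeight a t hq).mul_right (B * C)) fun m => ?_
  rw [phiTerm, norm_mul, norm_mul]
  gcongr
  exacts [hB m, hC m]

/-- With `v_m = (1 - q^m) * phiTerm a t q m`, the termwise difference of the two sides is `(1 - a t)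
(v_m - v_{m+1})`, which telescopes to zero since `v_0 = 0`. -/
theorem tsum_phiTerm_step {a t q : ℂ} (hq : ‖q‖ < 1) (h : ∀ i : ℕ, 1 - q ^ i * (a * t) ≠ 0) :
    (1 - a * t) * ∑' m, phiTerm a t q m = (1 - t) * ∑' m, phiTerm a (q * t) q m := by
  have h' : ∀ i : ℕ, 1 - q ^ i * (a * (q * t)) ≠ 0 := fun i => by
    have := h (i + 1)
    rwa [show q ^ (i + 1) * (a * t) = q ^ i * (a * (q * t)) by ring] at this
  have hs := summable_phiTerm hq h
  have hs' := summable_phiTerm hq h'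
  have hv : Summable fun m => (1 - q ^ m) * phiTerm a t q m := by
    refine Summable.of_norm_bounded (hs.norm.mul_left 2) fun m => ?_
    rw [norm_mul]
    gcongr
    calc ‖1 - q ^ m‖ ≤ ‖(1 : ℂ)‖ + ‖q ^ m‖ := norm_sub_le _ _
      _ ≤ 1 + 1 := by
        rw [norm_one, norm_pow]
        gcongr
        exact pow_le_one₀ (norm_nonneg _) hq.le
      _ = 2 := by norm_num
  have hv0 := hv.tsum_eq_zero_add
  rw [pow_zero, sub_self, zero_mul, zero_add, ← sub_eq_zero,
    ← hv.tsum_sub ((summable_nat_add_iff 1).mpr hv)] at hv0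
  rw [← sub_eq_zero, ← tsum_mul_left, ← tsum_mul_left,
    ← (hs.mul_left _).tsum_sub (hs'.mul_left _), ← mul_zero (1 - a * t), ← hv0, ← tsum_mul_left]
  refine tsum_congr fun m => ?_
  have e1 := qPoch_ne_zero (one_sub_pow_mul_ne_zero hq.le hq) m
  have e2 := qPoch_ne_zero h m
  have e2' := qPoch_ne_zero h' m
  have e3 := one_sub_pow_mul_ne_zero hq.le hq m
  have e4 := h m
  have e5 := h 0
  rw [pow_zero, one_mul] at e5
  have e6 : qPoch (a * (q * t)) q m = qPoch (a * t) q m * (1 - q ^ m * (a * t)) / (1 - a * t) := by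
    rw [eq_div_iff e5, ← qPoch_succ, add_comm m 1, qPoch_add]
    simp only [qPoch, Finset.prod_range_one, pow_zero, one_mul, pow_one]
    rw [mul_comm]
    simp only [mul_left_comm]
  simp only [phiTerm, baileyWeight, qPoch_succ, e6, Nat.choose_succ_succ' m 1, Nat.choose_one_right,
    mul_pow, pow_succ, pow_add]
  have e7 : q ^ m * (a * t) = 1 - (1 - q ^ m * (a * t)) := by ring
  generalize 1 - q ^ m * (a * t) = d at e4 e7 ⊢
  field_simp
  linear_combination (qPoch a q m * q ^ m.choose 2 * q ^ m * t ^ m) * e7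

/-- Iterating the functional equation moves `t` to `q^N t → 0`, where only the term `m = 0`
survives. -/
theorem hasSum_phiTerm {a t q : ℂ} (hq : ‖q‖ < 1) (h : ∀ i : ℕ, 1 - q ^ i * (a * t) ≠ 0) :
    HasSum (phiTerm a t q) (qPochInf t q / qPochInf (a * t) q) := by
  have h' : ∀ N i : ℕ, 1 - q ^ i * (a * (q ^ N * t)) ≠ 0 := fun N i => by
    have := h (N + i)
    rwa [show q ^ (N + i) * (a * t) = q ^ i * (a * (q ^ N * t)) by ring] at this
  have hiter : ∀ N : ℕ, qPoch (a * t) q N * ∑' m, phiTerm a t q m =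
      qPoch t q N * ∑' m, phiTerm a (q ^ N * t) q m := by
    intro N
    induction N with
    | zero => simp [qPoch_zero]
    | succ N ih =>
      have := tsum_phiTerm_step hq (h' N)
      rw [qPoch_succ, qPoch_succ, pow_succ', mul_assoc q]
      linear_combination (1 - q ^ N * (a * t)) * ih + qPoch t q N * this
  obtain ⟨A, hA0, hA⟩ := exists_norm_qPoch_le (a * t) hq
  obtain ⟨B, hB0, hB⟩ := exists_norm_inv_qPoch_le hq (one_sub_pow_mul_ne_zero hq.le hq)
  obtain ⟨C, hC0, hC⟩ := exists_norm_inv_qPoch_le hq h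
  have hlim : Tendsto (fun N : ℕ => ∑' m, phiTerm a (q ^ N * t) q m) atTop
      (𝓝 (∑' m, phiTerm a 0 q m)) := by
    refine tendsto_tsum_of_dominated_convergence
      ((summable_baileyWeight a t hq).mul_right (B * (A * C))) (fun m => ?_)
      (Eventually.of_forall fun N m => ?_)
    · have hc : ContinuousAt (fun τ => phiTerm a τ q m) 0 := by
        unfold phiTerm baileyWeight
        refine ContinuousAt.mul (by fun_prop) (continuousAt_const.mul (ContinuousAt.inv₀ ?_ ?_))
        · unfold qPoch
          fun_prop
        · simp [qPoch]
      refine hc.tendsto.comp ?_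
      simpa using (tendsto_pow_atTop_nhds_zero_of_norm_lt_one hq).mul_const t
    -- Rewriting over the fixed base point `a t` bounds this reciprocal uniformly in both `N` and
    -- `m`.
    · have e : (qPoch (a * (q ^ N * t)) q m)⁻¹ =
          qPoch (a * t) q N * (qPoch (a * t) q (N + m))⁻¹ := by
        have e1 := qPoch_ne_zero h N
        have e2 := qPoch_ne_zero (h' N) m
        rw [qPoch_add, show q ^ N * (a * t) = a * (q ^ N * t) by ring]
        field_simp
      rw [phiTerm, norm_mul, norm_mul, e, norm_mul (qPoch (a * t) q N)]
      gcongr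
      · rw [baileyWeight, baileyWeight, mul_pow, norm_mul, norm_mul, norm_mul, norm_mul,
          norm_mul, norm_mul]
        rw [← norm_mul ((-1) ^ m)]
        gcongr
        rw [norm_pow (q ^ N)]
        exact mul_le_of_le_one_left (norm_nonneg _)
          (pow_le_one₀ (norm_nonneg _) ((norm_pow q N).trans_le (pow_le_one₀ (norm_nonneg _) hq.le)))
      exacts [hB m, hA N, hC _]
  have hone : ∑' m, phiTerm a 0 q m = 1 := by
    rw [tsum_eq_single 0]
    · simp [phiTerm, baileyWeight, qPoch]
    · intro m hm
      simp [phiTerm, baileyWeight, hm]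
  have heq := tendsto_nhds_unique (((tendsto_qPoch (a * t) hq).mul_const _).congr hiter)
    ((tendsto_qPoch t hq).mul hlim)
  refine (summable_phiTerm hq h).hasSum.of_eq (fun _ => rfl) ?_
  rw [eq_div_iff (qPochInf_ne_zero hq h), mul_comm, heq, hone, mul_one]

/-- The conjugate Bailey pair attached to `baileyWeight`. -/
theorem hasSum_conjugateBailey {ρ t q : ℂ} (hq : ‖q‖ < 1) {r : ℕ} (hρ : ρ * t = q ^ (r + 1))
    (k : ℕ) :
    HasSum (fun n : ℕ => baileyWeight ρ t q n * (invPoch q (n - k) * invPoch q (n + r + k)))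
      (baileyWeight ρ t q k * qPochInf (q ^ k * t) q / qPochInf q q) := by
  have hqq := one_sub_pow_mul_ne_zero hq.le hq
  -- After `n = k + m`, the balancing condition on `ρ t` makes `(q;q)_{n+r+k}` supply exactly the
  -- lower parameter of the `₁φ₁` series.
  have hat : q ^ k * ρ * (q ^ k * t) = q ^ (2 * k + r) * q := by
    linear_combination q ^ (2 * k) * hρ
  have hne : ∀ i : ℕ, 1 - q ^ i * (q ^ k * ρ * (q ^ k * t)) ≠ 0 := fun i => by
    have := hqq (i + (2 * k + r))
    rwa [hat, ← mul_assoc, ← pow_add]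
  rw [← hasSum_nat_add_iff' k, Finset.sum_eq_zero fun n hn => by
    rw [invPoch_of_neg q (m := (n : ℤ) - k) (by simp at hn; omega)]; simp, sub_zero]
  refine ((hasSum_phiTerm hq hne).mul_left
    (baileyWeight ρ t q k * (qPoch q q (2 * k + r))⁻¹)).of_eq (fun m => ?_) ?_
  · rw [phiTerm, hat, add_comm m k, baileyWeight_add,
      show ((k + m : ℕ) : ℤ) - k = (m : ℕ) by push_cast; ring,
      show ((k + m : ℕ) : ℤ) + r + k = (2 * k + r + m : ℕ) by push_cast; ring,
      invPoch_natCast, invPoch_natCast, qPoch_add, mul_inv]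
    ring
  · rw [qPochInf_eq_mul q hq (2 * k + r), hat]
    have h1 := qPoch_ne_zero hqq (2 * k + r)
    field_simp

theorem summable_baileyWeight_div {ρ t x y q : ℂ} (hq : ‖q‖ < 1)
    (hx : ∀ n : ℕ, 1 - q ^ n * x ≠ 0) (hy : ∀ n : ℕ, 1 - q ^ n * y ≠ 0) (i j : ℕ) :
    Summable fun n : ℕ => baileyWeight ρ t q n / (qPoch x q (n + i) * qPoch y q (n + j)) := by
  obtain ⟨B, hB0, hB⟩ := exists_norm_inv_qPoch_le hq hx
  obtain ⟨C, hC0, hC⟩ := exists_norm_inv_qPoch_le hq hy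
  refine Summable.of_norm_bounded ((summable_baileyWeight ρ t hq).mul_right (B * C)) fun n => ?_
  rw [div_eq_mul_inv, mul_inv, norm_mul, norm_mul]
  gcongr
  exacts [hB _, hC _]

/-- Summing the partial fraction decompositions against a sequence of weights. -/
theorem hasSum_lerchTerm_mul {ρ t q : ℂ} (hq0 : q ≠ 0) (hq : ‖q‖ < 1) {x : ℂ} (hx0 : x ≠ 0)
    (hx : ∀ k : ℤ, 1 - x * q ^ k ≠ 0) (r : ℕ) {G : ℤ → ℂ}
    (hG : ∀ k : ℤ, HasSum (fun n : ℕ => baileyWeight ρ t q n *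
      (invPoch q (n - k) * invPoch q (n + r + k))) (G k)) :
    HasSum (fun k => lerchTerm x q k * G k)
      (∑' n : ℕ, baileyWeight ρ t q n / (qPoch x q (n + 1) * qPoch (q / x) q (n + r))) := by
  obtain ⟨B, hB0, hB⟩ := exists_norm_invPoch_le hq
  have hsum : Summable fun p : ℤ × ℕ => lerchTerm x q p.1 * (baileyWeight ρ t q p.2 *
      (invPoch q (p.2 - p.1) * invPoch q (p.2 + r + p.1))) := by
    refine Summable.of_norm_bounded (((summable_lerchTerm hq0 hq hx0).mul_of_nonneg
      (summable_baileyWeight ρ t hq) (fun _ => norm_nonneg _) (fun _ => norm_nonneg _)).mul_right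
        (B * B)) fun p => ?_
    rw [norm_mul, norm_mul, norm_mul, mul_assoc]
    gcongr
    exacts [hB _, hB _]
  have h1 := hsum.hasSum.prod_fiberwise (fun k => (hG k).mul_left (lerchTerm x q k))
  refine h1.of_eq (fun _ => rfl) ?_
  -- Summing over `k` first recovers the partial fractions with `N = n`, `M = n + r`.
  rw [← (Equiv.prodComm ℕ ℤ).tsum_eq]
  have h2 := ((Equiv.prodComm ℕ ℤ).summable_iff.mpr hsum).hasSum.prod_fiberwise (fun n => by
    refine ((hasSum_partialFraction hq0 hq hx0 hx n (n + r)).mul_left (baileyWeight ρ t q n)).of_eq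
      (fun k => ?_) rfl
    simp only [Function.comp, Equiv.prodComm_apply, Prod.swap, lerchTerm]
    push_cast
    ring)
  simp only [mul_one_div] at h2
  exact h2.tsum_eq.symm

/-! ### Product identities for theta functions -/

theorem qPoch_mul (x q : ℂ) (m n : ℕ) :
    qPoch x q (m * n) = ∏ r ∈ Finset.range m, qPoch (q ^ r * x) (q ^ m) n := by
  induction n with
  | zero => simp [qPoch_zero]
  | succ n ih =>
    rw [Nat.mul_succ, qPoch_add, ih]
    simp only [qPoch_succ, Finset.prod_mul_distrib]
    congr 1
    exact Finset.prod_congr rfl fun r _ => by ring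

theorem norm_pow_lt_one {q : ℂ} (hq : ‖q‖ < 1) {m : ℕ} (hm : m ≠ 0) : ‖q ^ m‖ < 1 := by
  rw [norm_pow]
  exact pow_lt_one₀ (norm_nonneg _) hq hm

theorem qPochInf_eq_prod (x : ℂ) {q : ℂ} (hq : ‖q‖ < 1) {m : ℕ} (hm : m ≠ 0) :
    qPochInf x q = ∏ r ∈ Finset.range m, qPochInf (q ^ r * x) (q ^ m) := by
  have h1 : Tendsto (fun n => qPoch x q (m * n)) atTop (𝓝 (qPochInf x q)) :=
    (tendsto_qPoch x hq).comp (tendsto_id.const_mul_atTop' (Nat.pos_of_ne_zero hm))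
  refine tendsto_nhds_unique h1 ?_
  simp only [qPoch_mul]
  exact tendsto_finsetProd _ fun r _ => tendsto_qPoch _ (norm_pow_lt_one hq hm)

theorem qPochInf_mul_neg (x : ℂ) {q : ℂ} (hq : ‖q‖ < 1) :
    qPochInf x q * qPochInf (-x) q = qPochInf (x ^ 2) (q ^ 2) := by
  refine tendsto_nhds_unique ((tendsto_qPoch x hq).mul (tendsto_qPoch (-x) hq))
    ((tendsto_qPoch _ (norm_pow_lt_one hq two_ne_zero)).congr fun n => ?_)
  simp only [qPoch, ← Finset.prod_mul_distrib]
  exact Finset.prod_congr rfl fun i _ => by ring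

theorem thetaJam_one_two {q : ℂ} (hq0 : q ≠ 0) :
    thetaJam 1 2 q = qPochInf q (q ^ 2) ^ 2 * qPochInf (q ^ 2) (q ^ 2) := by
  rw [thetaJam, thetaJ, zpow_one, show q ^ 2 / q = q by field_simp]
  ring

/-- The three factors of `j(q^2;q^6)` are the residue classes modulo 3 of the factors of
`(q^2;q^2)_∞`. -/
theorem thetaJm_two {q : ℂ} (hq0 : q ≠ 0) (hq : ‖q‖ < 1) :
    thetaJm 2 q = qPochInf (q ^ 2) (q ^ 2) := by
  rw [qPochInf_eq_prod (q ^ 2) (norm_pow_lt_one hq two_ne_zero) three_ne_zero, thetaJm, thetaJam,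
    thetaJ]
  simp only [Finset.prod_range_succ, Finset.prod_range_zero, one_mul, Nat.cast_ofNat]
  rw [show q ^ (2 : ℤ) = q ^ 2 from zpow_natCast q 2, show q ^ (2 * 3) / q ^ 2 = q ^ 4 by
    field_simp]
  ring_nf

theorem qPochInf_self {q : ℂ} (hq : ‖q‖ < 1) :
    qPochInf q q = qPochInf q (q ^ 2) * qPochInf (q ^ 2) (q ^ 2) := by
  rw [qPochInf_eq_prod q hq two_ne_zero]
  simp [Finset.prod_range_succ, sq]

theorem thetaJam_one_two_ne_zero {q : ℂ} (hq0 : q ≠ 0) (hq : ‖q‖ < 1) : thetaJam 1 2 q ≠ 0 := by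
  have hq2 := norm_pow_lt_one hq two_ne_zero
  rw [thetaJam_one_two hq0]
  exact mul_ne_zero (pow_ne_zero _ (qPochInf_ne_zero hq2 (one_sub_pow_mul_ne_zero hq2.le hq)))
    (qPochInf_ne_zero hq2 (one_sub_pow_mul_ne_zero hq2.le hq2))

/-- Gauss's product: `(q; q)_∞ / (-q; q)_∞ = J_{1,2}`. -/
theorem qPochInf_neg_mul_thetaJam {q : ℂ} (hq0 : q ≠ 0) (hq : ‖q‖ < 1) :
    qPochInf (-q) q * thetaJam 1 2 q = qPochInf q q := by
  have hq2 := norm_pow_lt_one hq two_ne_zero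
  have h1 := qPochInf_ne_zero hq2 (one_sub_pow_mul_ne_zero hq2.le hq2)
  have h2 := qPochInf_mul_neg q hq
  rw [thetaJam_one_two hq0]
  -- Euler's identity, from `(q;q)_∞ (-q;q)_∞ = (q^2;q^2)_∞` by cancelling `(q^2;q^2)_∞`.
  have h3 : qPochInf (-q) q * qPochInf q (q ^ 2) = 1 := by
    rw [qPochInf_self hq] at h2
    exact mul_left_cancel₀ h1 (by linear_combination h2)
  rw [qPochInf_self hq]
  linear_combination qPochInf q (q ^ 2) * qPochInf (q ^ 2) (q ^ 2) * h3

/-! ### Appell-type forms of the Eulerian series -/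

/-- The conjugate Bailey pair is symmetric under `k ↦ -r - k`. -/
theorem hasSum_conjugateBailey_neg {ρ t q : ℂ} (hq : ‖q‖ < 1) {r : ℕ} (hρ : ρ * t = q ^ (r + 1))
    (k : ℕ) {l : ℤ} (hl : l = -r - k) :
    HasSum (fun n : ℕ => baileyWeight ρ t q n * (invPoch q (n - l) * invPoch q (n + r + l)))
      (baileyWeight ρ t q k * qPochInf (q ^ k * t) q / qPochInf q q) := by
  refine (hasSum_conjugateBailey hq hρ k).of_eq (fun n => ?_) rfl
  rw [show (n : ℤ) - l = n + r + k by omega, show (n : ℤ) + r + l = n - k by omega]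
  ring

theorem exists_eq_natCast_or (k : ℤ) : ∃ n : ℕ, k = n ∨ k = -1 - n := by
  cases k with
  | ofNat n => exact ⟨n, Or.inl rfl⟩
  | negSucc n => exact ⟨n, Or.inr (by omega)⟩

/-- The Appell-type form of `∑ q^{n(n+1)/2} (-q; q)_n / ((x; q)_{n+1} (q/x; q)_{n+1})`. -/
theorem hasSum_mockTheta {q : ℂ} (hq0 : q ≠ 0) (hq : ‖q‖ < 1) {x : ℂ} (hx0 : x ≠ 0)
    (hx : ∀ k : ℤ, 1 - x * q ^ k ≠ 0) :
    HasSum (fun k => lerchTerm x q k * (qPochInf (-q) q / qPochInf q q * q ^ tri k))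
      (∑' n : ℕ, baileyWeight (-q) (-q) q n / (qPoch x q (n + 1) * qPoch (q / x) q (n + 1))) := by
  have hρ : -q * -q = q ^ (1 + 1) := by ring
  refine hasSum_lerchTerm_mul hq0 hq hx0 hx 1 fun k => ?_
  have hval : ∀ n : ℕ, baileyWeight (-q) (-q) q n * qPochInf (q ^ n * -q) q / qPochInf q q =
      qPochInf (-q) q / qPochInf q q * q ^ tri n := fun n => by
    rw [qPochInf_eq_mul (-q) hq n, baileyWeight, tri_natCast, zpow_natCast,
      Nat.choose_succ_succ' n 1, Nat.choose_one_right, pow_add]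
    have h1 : ((-1 : ℂ) ^ n) * (-1) ^ n = 1 := by rw [← mul_pow]; norm_num
    rw [neg_pow q n]
    linear_combination qPoch (-q) q n * q ^ n.choose 2 * q ^ n * qPochInf (q ^ n * -q) q /
      qPochInf q q * h1
  rcases exists_eq_natCast_or k with ⟨n, rfl | rfl⟩
  · rw [← hval]
    exact hasSum_conjugateBailey hq hρ n
  · rw [tri_neg_sub_one, ← hval]
    exact hasSum_conjugateBailey_neg hq hρ n (by simp)

/-- Termwise `1/(1-y) + 1/(1+y) = 2/(1-y^2)` with `y = x q^k`, and the numerator `(-1)^k q^(k(k+1))`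
is already that of the basic sum in base `q^2`. -/
theorem mockTheta_add_neg {q : ℂ} (hq0 : q ≠ 0) (hq : ‖q‖ < 1) {x : ℂ} (hx0 : x ≠ 0)
    (hx : ∀ k : ℤ, 1 - x * q ^ k ≠ 0) (hx' : ∀ k : ℤ, 1 - -x * q ^ k ≠ 0) :
    (∑' n : ℕ, baileyWeight (-q) (-q) q n / (qPoch x q (n + 1) * qPoch (q / x) q (n + 1))) +
      ∑' n : ℕ, baileyWeight (-q) (-q) q n / (qPoch (-x) q (n + 1) * qPoch (q / -x) q (n + 1)) =
    2 * (thetaJm 2 q ^ 3 / (thetaJam 1 2 q * thetaJ (x ^ 2) (q ^ 2))) := by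
  have h1 := hasSum_mockTheta hq0 hq hx0 hx
  have h2 := hasSum_mockTheta hq0 hq (neg_ne_zero.mpr hx0) hx'
  have hq2 := norm_pow_lt_one hq two_ne_zero
  have hz : ∀ k : ℤ, (q ^ 2) ^ k = q ^ k * q ^ k := fun k => by rw [sq, mul_zpow]
  have hx2 : ∀ k : ℤ, 1 - x ^ 2 * (q ^ 2) ^ k ≠ 0 := fun k => by
    rw [hz, show 1 - x ^ 2 * (q ^ k * q ^ k) = (1 - x * q ^ k) * (1 - -x * q ^ k) by ring]
    exact mul_ne_zero (hx k) (hx' k)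
  have h3 := (hasSum_lerchTerm (pow_ne_zero 2 hq0) hq2 (pow_ne_zero 2 hx0) hx2).mul_left
    (2 * (qPochInf (-q) q / qPochInf q q))
  refine ((h1.add h2).unique (h3.of_eq (fun k => ?_) rfl)).trans ?_
  · have e1 := hx k
    have e2 := hx' k
    have e3 := hx2 k
    have e4 : 1 - x ^ 2 * (q ^ 2) ^ k = (1 - x * q ^ k) * (1 - -x * q ^ k) := by rw [hz]; ring
    rw [lerchTerm, lerchTerm, lerchTerm, e4, hz]
    rw [neg_mul, sub_neg_eq_add] at e2 ⊢
    field_simp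
    ring
  · rw [← qPochInf_neg_mul_thetaJam hq0 hq, thetaJm_two hq0 hq]
    have e1 : qPochInf (-q) q ≠ 0 := fun h => by
      have := qPochInf_neg_mul_thetaJam hq0 hq
      rw [h, zero_mul] at this
      exact qPochInf_ne_zero hq (one_sub_pow_mul_ne_zero hq.le hq) this.symm
    have e2 := thetaJam_one_two_ne_zero hq0 hq
    field_simp

theorem two_mul_choose_two_add (n : ℕ) : 2 * n.choose 2 + n = n ^ 2 := by
  induction n with
  | zero => rfl
  | succ n ih =>
    rw [Nat.choose_succ_succ' n 1, Nat.choose_one_right]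
    linarith

/-- The Appell-type form of
`∑ (-1)^n q^{n^2} (q; q^2)_n / ((x; q^2)_{n+1} (q^2/x; q^2)_n)`. -/
theorem hasSum_lerchTerm_even {q : ℂ} (hq0 : q ≠ 0) (hq : ‖q‖ < 1) {x : ℂ} (hx0 : x ≠ 0)
    (hx : ∀ k : ℤ, 1 - x * q ^ k ≠ 0) :
    HasSum (fun k => qPochInf q (q ^ 2) / qPochInf (q ^ 2) (q ^ 2) * lerchTerm x q (2 * k))
      (∑' n : ℕ, baileyWeight q q (q ^ 2) n /
        (qPoch x (q ^ 2) (n + 1) * qPoch (q ^ 2 / x) (q ^ 2) (n + 0))) := by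
  have hρ : q * q = (q ^ 2) ^ (0 + 1) := by ring
  have hq2 := norm_pow_lt_one hq two_ne_zero
  have hz : ∀ k : ℤ, (q ^ 2) ^ k = q ^ (2 * k) := fun k => by
    rw [zpow_mul, zpow_ofNat]
  have hx2 : ∀ k : ℤ, 1 - x * (q ^ 2) ^ k ≠ 0 := fun k => by rw [hz]; exact hx _
  have hval : ∀ n : ℕ, baileyWeight q q (q ^ 2) n * qPochInf ((q ^ 2) ^ n * q) (q ^ 2) /
      qPochInf (q ^ 2) (q ^ 2) =
      qPochInf q (q ^ 2) / qPochInf (q ^ 2) (q ^ 2) * ((-1) ^ (n : ℤ) * q ^ ((n : ℤ) ^ 2)) :=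
    fun n => by
    rw [qPochInf_eq_mul q hq2 n, baileyWeight, ← pow_mul, mul_assoc _ (q ^ _), ← pow_add,
      two_mul_choose_two_add, zpow_natCast, ← Nat.cast_pow, zpow_natCast]
    ring
  have h := hasSum_lerchTerm_mul (ρ := q) (t := q) (pow_ne_zero 2 hq0) hq2 hx0 hx2 0
    (G := fun k => qPochInf q (q ^ 2) / qPochInf (q ^ 2) (q ^ 2) * ((-1) ^ k * q ^ k ^ 2))
    fun k => by
      obtain ⟨n, rfl | rfl⟩ := Int.eq_nat_or_neg k
      · rw [← hval]
        exact hasSum_conjugateBailey hq2 hρ n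
      · rw [neg_sq, zpow_neg, ← inv_zpow, inv_neg_one, ← hval]
        exact hasSum_conjugateBailey_neg hq2 hρ n (by simp)
  refine h.of_eq (fun k => ?_) rfl
  -- The factor `q^(k^2)` from the conjugate pair is what turns the base-`q^2` term into the
  -- base-`q` term of index `2k`.
  have e1 : tri (2 * k) = 2 * tri k + k ^ 2 := by
    have h := two_mul_tri k
    have h' := two_mul_tri (2 * k)
    linarith
  have e2 : (-1 : ℂ) ^ k * (-1) ^ k = 1 := by rw [← mul_zpow]; norm_num
  rw [lerchTerm, lerchTerm, hz, hz, e1, zpow_add₀ hq0, zpow_mul (-1 : ℂ)]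
  norm_num
  linear_combination -qPochInf q (q ^ 2) / qPochInf (q ^ 2) (q ^ 2) * q ^ (2 * tri k) * q ^ k ^ 2 /
    (1 - x * q ^ (2 * k)) * e2

/-- The Appell-type form of
`∑ (-1)^n q^{n^2+2n} (q; q^2)_n / ((x q; q^2)_{n+1} (q/x; q^2)_{n+1})`. -/
theorem hasSum_lerchTerm_odd {q : ℂ} (hq0 : q ≠ 0) (hq : ‖q‖ < 1) {x : ℂ} (hx0 : x ≠ 0)
    (hx : ∀ k : ℤ, 1 - x * q ^ k ≠ 0) :
    HasSum (fun k => qPochInf q (q ^ 2) / qPochInf (q ^ 2) (q ^ 2) * lerchTerm x q (2 * k + 1))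
      (q * (1 - x) / x * ∑' n : ℕ, baileyWeight q (q ^ 3) (q ^ 2) n /
        (qPoch (x * q) (q ^ 2) (n + 1) * qPoch (q ^ 2 / (x * q)) (q ^ 2) (n + 1))) := by
  have hρ : q * q ^ 3 = (q ^ 2) ^ (1 + 1) := by ring
  have hq2 := norm_pow_lt_one hq two_ne_zero
  have hz : ∀ k : ℤ, (q ^ 2) ^ k = q ^ (2 * k) := fun k => by
    rw [zpow_mul, zpow_ofNat]
  have hx2 : ∀ k : ℤ, 1 - x * q * (q ^ 2) ^ k ≠ 0 := fun k => by
    rw [hz, mul_assoc, ← zpow_one_add₀ hq0]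
    exact hx _
  have hval : ∀ n : ℕ, baileyWeight q (q ^ 3) (q ^ 2) n *
      qPochInf ((q ^ 2) ^ n * q ^ 3) (q ^ 2) / qPochInf (q ^ 2) (q ^ 2) =
      qPochInf q (q ^ 2) / qPochInf (q ^ 2) (q ^ 2) *
        ((-1) ^ n * q ^ (n ^ 2 + 2 * n) / (1 - q ^ (2 * n + 1))) := fun n => by
    have h1 := one_sub_pow_ne_zero hq (n := 2 * n + 1) (by omega)
    have h2 : (q ^ 2) ^ (n + 1) * q = (q ^ 2) ^ n * q ^ 3 := by ring
    rw [qPochInf_eq_mul q hq2 (n + 1), qPoch_succ, h2, ← two_mul_choose_two_add, baileyWeight,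
      show (q ^ 2) ^ n * q = q ^ (2 * n + 1) by ring]
    field_simp
    ring
  -- Since `r = 1`, the values on negative indices are the reflections under `k ↦ -1-k`.
  obtain ⟨G, hG⟩ : ∃ G : ℤ → ℂ, ∀ n : ℕ, G n = qPochInf q (q ^ 2) / qPochInf (q ^ 2) (q ^ 2) *
        ((-1) ^ n * q ^ (n ^ 2 + 2 * n) / (1 - q ^ (2 * n + 1))) ∧ G (-(n + 1)) = G n :=
    ⟨fun k => match k with
      | Int.ofNat n => qPochInf q (q ^ 2) / qPochInf (q ^ 2) (q ^ 2) *
        ((-1) ^ n * q ^ (n ^ 2 + 2 * n) / (1 - q ^ (2 * n + 1)))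
      | Int.negSucc n => qPochInf q (q ^ 2) / qPochInf (q ^ 2) (q ^ 2) *
        ((-1) ^ n * q ^ (n ^ 2 + 2 * n) / (1 - q ^ (2 * n + 1))), fun n => ⟨rfl, rfl⟩⟩
  have h := hasSum_lerchTerm_mul (ρ := q) (t := q ^ 3) (pow_ne_zero 2 hq0) hq2
    (mul_ne_zero hx0 hq0) hx2 1 (G := G) fun k => by
      obtain ⟨n, rfl | rfl⟩ := exists_eq_natCast_or k
      · rw [(hG n).1, ← hval]
        exact hasSum_conjugateBailey hq2 hρ n
      · rw [show (-1 - n : ℤ) = -(n + 1) by ring, (hG n).2, (hG n).1, ← hval]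
        exact hasSum_conjugateBailey_neg hq2 hρ n (by push_cast; ring)
  have hs : Summable fun k => qPochInf q (q ^ 2) / qPochInf (q ^ 2) (q ^ 2) *
      lerchTerm x q (2 * k + 1) :=
    ((summable_lerchTerm hq0 hq hx0).of_norm.comp_injective
      (i := fun k : ℤ => 2 * k + 1) (fun a b hab => by simpa using hab)).mul_left _
  refine hs.hasSum.of_eq (fun _ => rfl) ?_
  -- The two bilateral series are compared after pairing `n` with `-1-n`. With `u = q^(2n+1)`, one
  -- side has `1/(1-xu) + 1/(u-x)`, whose numerator is `(1-x)(1+u)`; the other has `1/(1-xu) -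
  -- u/(u-x)`, with numerator `-x(1-u^2)`, and `1-u` cancels against `G`.
  refine hs.hasSum.nat_add_neg_add_one.unique
    ((h.nat_add_neg_add_one.mul_left (q * (1 - x) / x)).of_eq (fun n => ?_) rfl)
  have hu0 : q ^ (2 * n + 1) ≠ 0 := pow_ne_zero _ hq0
  have hu1 := one_sub_pow_ne_zero hq (n := 2 * n + 1) (by omega)
  have hxu : 1 - x * q ^ (2 * n + 1) ≠ 0 := by
    simpa only [← zpow_natCast] using hx (2 * n + 1 : ℕ)
  have hux : q ^ (2 * n + 1) - x ≠ 0 := fun h => by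
    refine hx (-(2 * n + 1 : ℕ)) ?_
    rw [zpow_neg, zpow_natCast, ← sub_eq_zero.mp h, mul_inv_cancel₀ hu0, sub_self]
  have hs1 : (-1 : ℂ) ^ n * (-1) ^ n = 1 := by rw [← mul_pow]; norm_num
  have t0 := two_mul_tri n
  have l1 : lerchTerm x q (2 * n + 1) =
      -(q ^ (2 * tri n) * q ^ (n ^ 2 + 2 * n) * q) / (1 - x * q ^ (2 * n + 1)) := by
    have t1 := two_mul_tri (2 * n + 1)
    rw [lerchTerm, show tri (2 * n + 1) = 2 * tri n + (n ^ 2 + 2 * n : ℕ) + 1 by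
      push_cast; linarith, zpow_add₀ hq0, zpow_add₀ hq0, zpow_natCast, zpow_one,
      show (2 * n + 1 : ℤ) = (2 * n + 1 : ℕ) by push_cast; ring, zpow_natCast, zpow_natCast,
      pow_succ (-1 : ℂ), pow_mul]
    norm_num
  have l2 : lerchTerm x q (2 * -(n + 1) + 1) =
      -(q ^ (2 * tri n) * q ^ (n ^ 2 + 2 * n) * q) / (q ^ (2 * n + 1) - x) := by
    have t1 := two_mul_tri (-(2 * n + 1 : ℕ))
    rw [show (2 * -(n + 1) + 1 : ℤ) = -(2 * n + 1 : ℕ) by push_cast; ring, lerchTerm,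
      show tri (-(2 * n + 1 : ℕ)) = 2 * tri n + (n ^ 2 + 2 * n : ℕ) + 1 - (2 * n + 1 : ℕ) by
        push_cast at t1 ⊢; linarith, zpow_sub₀ hq0, zpow_add₀ hq0, zpow_add₀ hq0, zpow_natCast,
      zpow_one, zpow_neg, zpow_neg, zpow_natCast, zpow_natCast, pow_succ (-1 : ℂ), pow_mul,
      show 1 - x * (q ^ (2 * n + 1))⁻¹ = (q ^ (2 * n + 1) - x) / q ^ (2 * n + 1) by field_simp]
    norm_num
    field_simp
  have l3 : lerchTerm (x * q) (q ^ 2) n =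
      (-1) ^ n * q ^ (2 * tri n) / (1 - x * q ^ (2 * n + 1)) := by
    rw [lerchTerm, hz, zpow_natCast, zpow_natCast, show x * q * (q ^ 2) ^ n = x * q ^ (2 * n + 1) by
      ring]
  have l4 : lerchTerm (x * q) (q ^ 2) (-(n + 1)) =
      -((-1) ^ n * q ^ (2 * tri n) * q ^ (2 * n + 1)) / (q ^ (2 * n + 1) - x) := by
    have h2 : x * q * (q ^ 2) ^ (-(n + 1) : ℤ) = x / q ^ (2 * n + 1) := by
      rw [show (-(n + 1) : ℤ) = -(n + 1 : ℕ) by push_cast; ring, zpow_neg, zpow_natCast,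
        ← pow_mul, show 2 * (n + 1) = (2 * n + 1) + 1 by ring, pow_succ q (2 * n + 1)]
      field_simp
    have h3 : (-1 : ℂ) ^ (-(n + 1) : ℤ) = -(-1) ^ n := by
      rw [zpow_neg, ← inv_zpow, inv_neg_one, zpow_add_one₀ (by norm_num), zpow_natCast]
      ring
    rw [lerchTerm, h2, h3, hz, show (-(n + 1) : ℤ) = -1 - n by ring, tri_neg_sub_one,
      show 1 - x / q ^ (2 * n + 1) = (q ^ (2 * n + 1) - x) / q ^ (2 * n + 1) by field_simp]
    field_simp
  rw [l1, l2, l3, l4, (hG n).2, (hG n).1]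
  generalize q ^ (2 * n + 1) = u at *
  generalize q ^ (2 * tri n) = R at *
  generalize q ^ (n ^ 2 + 2 * n) = W at *
  generalize qPochInf q (q ^ 2) / qPochInf (q ^ 2) (q ^ 2) = C at *
  generalize (-1 : ℂ) ^ n = s at *
  have e : q * (1 - x) / x * (s * R / (1 - x * u) * (C * (s * W / (1 - u))) +
      -(s * R * u) / (u - x) * (C * (s * W / (1 - u)))) =
      (s * s) * (q * (1 - x) / x * (R / (1 - x * u) * (C * (W / (1 - u))) +
      -(R * u) / (u - x) * (C * (W / (1 - u))))) := by ring
  rw [e, hs1]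
  field_simp
  ring

theorem hasSum_int_even_add_odd {f : ℤ → ℂ} {s t : ℂ} (he : HasSum (fun k => f (2 * k)) s)
    (ho : HasSum (fun k => f (2 * k + 1)) t) : HasSum f (s + t) := by
  have hi := mul_right_injective₀ (two_ne_zero' ℤ)
  replace ho := ((add_left_injective 1).comp hi).hasSum_range_iff.2 ho
  refine (hi.hasSum_range_iff.2 he).add_isCompl ?_ ho
  simpa [Function.comp_def] using Int.isCompl_even_odd

/-! ### Specialization to `q = e^{2πiz}` -/

theorem one_sub_ne_zero_of_norm_ne_one {w : ℂ} (h : ‖w‖ ≠ 1) : 1 - w ≠ 0 := fun h' =>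
  h (by rw [← sub_eq_zero.mp h', norm_one])

theorem norm_qPow (z : UpperHalfPlane) (r : ℝ) :
    ‖qPow z r‖ = Real.exp (-(2 * Real.pi * z.im * r)) := by
  rw [qPow, Complex.norm_exp]
  congr 1
  simp
  ring

theorem qPow_add (z : UpperHalfPlane) (r s : ℝ) : qPow z (r + s) = qPow z r * qPow z s := by
  rw [qPow, qPow, qPow, ← Complex.exp_add]
  congr 1
  push_cast
  ring

theorem qPow_one (z : UpperHalfPlane) : qPow z 1 = nome z := by simp [qPow, nome]

theorem qPow_ne_zero (z : UpperHalfPlane) (r : ℝ) : qPow z r ≠ 0 := Complex.exp_ne_zero _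

theorem nome_ne_zero (z : UpperHalfPlane) : nome z ≠ 0 := Complex.exp_ne_zero _

theorem nome_zpow (z : UpperHalfPlane) (k : ℤ) : nome z ^ k = qPow z k := by
  rw [nome, ← Complex.exp_int_mul, qPow]
  congr 1
  push_cast
  ring

theorem norm_qPow_eq_one_iff (z : UpperHalfPlane) (r : ℝ) : ‖qPow z r‖ = 1 ↔ r = 0 := by
  rw [norm_qPow, Real.exp_eq_one_iff, neg_eq_zero, mul_eq_zero]
  have : 2 * Real.pi * z.im ≠ 0 := by
    have := z.im_pos
    positivity
  tauto

theorem norm_nome_lt_one (z : UpperHalfPlane) : ‖nome z‖ < 1 := by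
  rw [← qPow_one, norm_qPow, Real.exp_lt_one_iff]
  have := z.im_pos
  have : 0 < 2 * Real.pi * z.im * 1 := by positivity
  linarith

/-- The product has modulus `|q^(r+k)|`, which is 1 only if `r + k = 0`, and `r` is not an integer.
-/
theorem one_sub_mul_qPow_ne_zero {z : UpperHalfPlane} {r : ℝ} (h0 : 0 < r) (h1 : r < 1) {ω : ℂ}
    (hω : ‖ω‖ = 1) (k : ℤ) : 1 - ω * qPow z r * nome z ^ k ≠ 0 := by
  refine one_sub_ne_zero_of_norm_ne_one ?_
  rw [nome_zpow, mul_assoc, ← qPow_add, norm_mul, hω, one_mul, Ne, norm_qPow_eq_one_iff]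
  intro h
  have h2 : (-1 : ℝ) < (k : ℝ) := by linarith
  have h3 : (k : ℝ) < 0 := by linarith
  have h4 : (-1 : ℤ) < k := by exact_mod_cast h2
  have h5 : k < 0 := by exact_mod_cast h3
  omega

theorem one_sub_mul_nome_zpow_ne_zero {z : UpperHalfPlane} {ω : ℂ} (hω : ‖ω‖ = 1) (hω1 : ω ≠ 1)
    (k : ℤ) : 1 - ω * nome z ^ k ≠ 0 := by
  rcases eq_or_ne k 0 with rfl | hk
  · rw [zpow_zero, mul_one, sub_ne_zero]
    exact hω1.symm
  · refine one_sub_ne_zero_of_norm_ne_one ?_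
    rw [norm_mul, hω, one_mul, nome_zpow, Ne, norm_qPow_eq_one_iff]
    exact_mod_cast hk

/-- The condition `ω^2 = 1` gives `q / (ω q^(a/c)) = ω q^(1-a/c)`, so the two denominator factors
have the form `x`, `q/x`. -/
theorem HPrimeTerm_eq (a c : ℕ) (z : UpperHalfPlane) {ω : ℂ} (hω : ω * ω = 1) (n : ℕ) :
    HPrimeTerm a c ω z n = baileyWeight (-nome z) (-nome z) (nome z) n /
      (qPoch (ω * qPow z (a / c)) (nome z) (n + 1) *
        qPoch (nome z / (ω * qPow z (a / c))) (nome z) (n + 1)) := by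
  have h1 : nome z / (ω * qPow z (a / c)) = ω * qPow z (1 - a / c) := by
    have hω0 : ω ≠ 0 := left_ne_zero_of_mul_eq_one hω
    rw [div_eq_iff (mul_ne_zero hω0 (qPow_ne_zero _ _)), mul_mul_mul_comm, hω, one_mul, ← qPow_add,
      sub_add_cancel, qPow_one]
  have h2 : nome z ^ (n * (n + 1) / 2) = (-1) ^ n * nome z ^ n.choose 2 * (-nome z) ^ n := by
    have h3 : ((-1 : ℂ) ^ n) * (-1) ^ n = 1 := by rw [← mul_pow]; norm_num
    have h4 : n * (n + 1) / 2 = n + n.choose 2 := by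
      have := Nat.choose_succ_succ' n 1
      rwa [Nat.choose_one_right, Nat.choose_two_right, add_tsub_cancel_right, mul_comm] at this
    rw [h4, neg_pow (nome z) n, pow_add]
    linear_combination -nome z ^ n * nome z ^ n.choose 2 * h3
  rw [HPrimeTerm, h1, baileyWeight, h2, mul_comm (qPoch _ _ n)]

theorem KPrimeTerm_eq (z : UpperHalfPlane) {ω : ℂ} (hω1 : ω ≠ 1) (n : ℕ) :
    KPrimeTerm ω z n = (1 - ω) * (baileyWeight (nome z) (nome z) (nome z ^ 2) n /
      (qPoch ω (nome z ^ 2) (n + 1) * qPoch (nome z ^ 2 / ω) (nome z ^ 2) (n + 0))) := by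
  have h1 : qPoch ω (nome z ^ 2) (n + 1) = (1 - ω) * qPoch (ω * nome z ^ 2) (nome z ^ 2) n := by
    rw [add_comm, qPoch_add, pow_one, mul_comm ω]
    simp [qPoch]
  have h2 : 1 - ω ≠ 0 := sub_ne_zero.mpr hω1.symm
  rw [KPrimeTerm, h1, baileyWeight, ← two_mul_choose_two_add, add_zero,
    show nome z ^ 2 / ω = ω⁻¹ * nome z ^ 2 by ring, mul_assoc (1 - ω), mul_div_assoc',
    mul_div_mul_left _ _ h2]
  ring

/-- The parameter `t = q^3` comes from `(n+1)^2 = n(n-1) + 3n + 1`. -/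
theorem KDoublePrimeTerm_eq (z : UpperHalfPlane) (ω : ℂ) (n : ℕ) :
    KDoublePrimeTerm ω z (n + 1) =
      -nome z * (baileyWeight (nome z) (nome z ^ 3) (nome z ^ 2) n /
        (qPoch (ω * nome z) (nome z ^ 2) (n + 1) *
          qPoch (nome z ^ 2 / (ω * nome z)) (nome z ^ 2) (n + 1))) := by
  have h1 : nome z ^ 2 / (ω * nome z) = ω⁻¹ * nome z := by
    have := nome_ne_zero z
    rw [mul_comm ω, ← div_div, sq, mul_self_div_self, div_eq_mul_inv, mul_comm]
  rw [KDoublePrimeTerm, h1, baileyWeight, add_tsub_cancel_right,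
    show (n + 1) ^ 2 = 2 * n.choose 2 + 3 * n + 1 by rw [add_sq, ← two_mul_choose_two_add]; ring]
  ring

/-- The two second order series combine to a theta quotient. -/
theorem KPrime_sub_KDoublePrime (z : UpperHalfPlane) {ω : ℂ} (hω : ‖ω‖ = 1) (hω1 : ω ≠ 1) :
    (1 - ω)⁻¹ * KPrime ω z - (1 - ω) / ω * KDoublePrime ω z =
      thetaJam 1 2 (nome z) ^ 2 / thetaJ ω (nome z) := by
  have hq0 := nome_ne_zero z
  have hq := norm_nome_lt_one z
  have hω0 : ω ≠ 0 := norm_ne_zero_iff.mp (by rw [hω]; norm_num)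
  have h1ω : 1 - ω ≠ 0 := sub_ne_zero.mpr hω1.symm
  have hx := one_sub_mul_nome_zpow_ne_zero (z := z) hω hω1
  -- `K'` supplies the even indices and `K''` the odd ones.
  have h := (hasSum_int_even_add_odd (f := fun k => qPochInf (nome z) (nome z ^ 2) /
    qPochInf (nome z ^ 2) (nome z ^ 2) * lerchTerm ω (nome z) k)
    (hasSum_lerchTerm_even hq0 hq hω0 hx) (hasSum_lerchTerm_odd hq0 hq hω0 hx)).unique
      ((hasSum_lerchTerm hq0 hq hω0 hx).mul_left _)
  have hK : KPrime ω z = _ := (tsum_congr (KPrimeTerm_eq z hω1)).trans tsum_mul_left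
  have hK' : KDoublePrime ω z = _ := (tsum_congr (KDoublePrimeTerm_eq z ω)).trans tsum_mul_left
  have hq2 := norm_pow_lt_one hq two_ne_zero
  have h2 := qPochInf_ne_zero hq2 (one_sub_pow_mul_ne_zero hq2.le hq2)
  rw [hK, hK', inv_mul_cancel_left₀ h1ω, thetaJam_one_two hq0]
  rw [qPochInf_self hq] at h
  have h3 := thetaJ_ne_zero hq0 hq hω0 hx
  refine Eq.trans ?_ (h.trans ?_)
  · ring
  · field_simp

theorem norm_zetaPow (c : ℕ) (r : ℝ) : ‖zetaPow c r‖ = 1 := by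
  rw [zetaPow, show 2 * Real.pi * I * r / c = ((2 * Real.pi * r / c : ℝ) : ℂ) * I by
    push_cast; ring]
  exact norm_exp_ofReal_mul_I _

theorem zetaPow_eq_sq (c : ℕ) (r : ℝ) : zetaPow c r = zetaPow c (r / 2) ^ 2 := by
  rw [zetaPow, zetaPow, ← Complex.exp_nat_mul]
  congr 1
  push_cast
  ring

theorem sin_eq_zetaPow (a c : ℕ) : (Real.sin (Real.pi * (a / c)) : ℂ) =
    ((zetaPow c (a / 2))⁻¹ - zetaPow c (a / 2)) * I / 2 := by
  rw [zetaPow, ← Complex.exp_neg, Complex.ofReal_sin, Complex.sin]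
  push_cast
  congr 4 <;> ring

end EulerianSeries

end

open EulerianSeries in
theorem theorem2p2 (a c : ℕ) (ha : 0 < a) (hac : a < c) (z : UpperHalfPlane) :
    -- all the Eulerian series involved converge (absolutely)
    (Summable (HPrimeTerm a c 1 z) ∧ Summable (HPrimeTerm a c (-1) z) ∧
      Summable (KPrimeTerm (zetaPow c a) z) ∧
      Summable (fun n : ℕ => KDoublePrimeTerm (zetaPow c a) z (n + 1))) ∧
    -- the theta functions in the denominators do not vanish
    (thetaJam 1 2 (nome z) ≠ 0 ∧ thetaJ (qPow z (2 * a / c)) (nome z ^ 2) ≠ 0 ∧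
      thetaJ (zetaPow c a) (nome z) ≠ 0) ∧
    HTilde a c z =
      2 * qPow z (a / c * (1 - a / c)) *
        (thetaJm 2 (nome z) ^ 3 /
          (thetaJam 1 2 (nome z) * thetaJ (qPow z (2 * a / c)) (nome z ^ 2))) ∧
    KTilde a c z =
      -(Complex.I * zetaPow c (a / 2) * qPow z (-1 / 8) / 2) *
        (thetaJam 1 2 (nome z) ^ 2 / thetaJ (zetaPow c a) (nome z)) := by

  have hq0 := nome_ne_zero z
  have hq := norm_nome_lt_one z
  have hq2 := norm_pow_lt_one hq two_ne_zero
  have hc : (0 : ℝ) < c := by exact_mod_cast ha.trans hac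
  have hr0 : (0 : ℝ) < a / c := div_pos (by exact_mod_cast ha) hc
  have hr1 : (a / c : ℝ) < 1 := (div_lt_one hc).mpr (by exact_mod_cast hac)
  have hH : ∀ ω : ℂ, ‖ω‖ = 1 → ω * ω = 1 → Summable (HPrimeTerm a c ω z) := fun ω hω hω2 => by
    have hx := one_sub_mul_qPow_ne_zero (z := z) hr0 hr1 hω
    rw [funext (HPrimeTerm_eq a c z hω2)]
    exact summable_baileyWeight_div hq (one_sub_pow_mul_ne_zero_of_zpow hx)
      (one_sub_pow_mul_div_ne_zero_of_zpow hq0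
        (mul_ne_zero (norm_ne_zero_iff.mp (by rw [hω]; norm_num)) (qPow_ne_zero _ _)) hx) 1 1
  have hsin : (Real.sin (Real.pi * (a / c)) : ℂ) ≠ 0 := by
    have := Real.sin_pos_of_pos_of_lt_pi (mul_pos Real.pi_pos hr0)
      (mul_lt_of_lt_one_right Real.pi_pos hr1)
    exact_mod_cast this.ne'
  have hs0 : zetaPow c (a / 2) ≠ 0 := Complex.exp_ne_zero _
  have hsq := zetaPow_eq_sq c a
  have hω := norm_zetaPow c a
  have hω0 : zetaPow c a ≠ 0 := Complex.exp_ne_zero _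
  have hω1 : zetaPow c a ≠ 1 := fun h => hsin <| by
    rw [sin_eq_zetaPow, inv_eq_of_mul_eq_one_left (a := zetaPow c (a / 2)) (by
      rw [← sq, ← hsq, h]), sub_self, zero_mul, zero_div]
  have hx := one_sub_mul_nome_zpow_ne_zero (z := z) hω hω1
  have hz : ∀ k : ℤ, (nome z ^ 2) ^ k = nome z ^ (2 * k) := fun k => by
    rw [zpow_mul, zpow_ofNat]
  have hK : Summable (KPrimeTerm (zetaPow c a) z) := by
    have hx2 : ∀ k : ℤ, 1 - zetaPow c a * (nome z ^ 2) ^ k ≠ 0 := fun k => by rw [hz]; exact hx _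
    rw [funext (KPrimeTerm_eq z hω1)]
    exact (summable_baileyWeight_div hq2 (one_sub_pow_mul_ne_zero_of_zpow hx2)
      (one_sub_pow_mul_div_ne_zero_of_zpow (pow_ne_zero 2 hq0) hω0 hx2) 1 0).mul_left _
  have hK' : Summable fun n : ℕ => KDoublePrimeTerm (zetaPow c a) z (n + 1) := by
    have hx2 : ∀ k : ℤ, 1 - zetaPow c a * nome z * (nome z ^ 2) ^ k ≠ 0 := fun k => by
      rw [hz, mul_assoc, ← zpow_one_add₀ hq0]
      exact hx _
    rw [funext (KDoublePrimeTerm_eq z _)]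
    exact (summable_baileyWeight_div hq2 (one_sub_pow_mul_ne_zero_of_zpow hx2)
      (one_sub_pow_mul_div_ne_zero_of_zpow (pow_ne_zero 2 hq0) (mul_ne_zero hω0 hq0) hx2)
        1 1).mul_left _
  have hy0 := qPow_ne_zero z (a / c)
  have hy : ∀ k : ℤ, 1 - qPow z (a / c) * nome z ^ k ≠ 0 := by
    simpa using one_sub_mul_qPow_ne_zero (z := z) hr0 hr1 (ω := 1) (by simp)
  have hy' : ∀ k : ℤ, 1 - -qPow z (a / c) * nome z ^ k ≠ 0 := by
    simpa using one_sub_mul_qPow_ne_zero (z := z) hr0 hr1 (ω := -1) (by simp)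
  have hy2 : qPow z (2 * a / c) = qPow z (a / c) ^ 2 := by
    rw [sq, ← qPow_add]
    congr 1
    ring
  refine ⟨⟨hH 1 (by simp) (by simp), hH (-1) (by simp) (by simp), hK, hK'⟩,
    ⟨thetaJam_one_two_ne_zero hq0 hq, ?_, thetaJ_ne_zero hq0 hq hω0 hx⟩, ?_, ?_⟩
  · rw [hy2]
    refine thetaJ_ne_zero (pow_ne_zero 2 hq0) hq2 (pow_ne_zero 2 hy0) fun k => ?_
    rw [show 1 - qPow z (a / c) ^ 2 * (nome z ^ 2) ^ k =
      (1 - qPow z (a / c) * nome z ^ k) * (1 - -qPow z (a / c) * nome z ^ k) by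
        rw [sq (nome z), mul_zpow]; ring]
    exact mul_ne_zero (hy k) (hy' k)
  · rw [HTilde, hy2, mul_comm 2, mul_assoc, ← mockTheta_add_neg hq0 hq hy0 hy hy', HPrime, HPrime,
      tsum_congr (HPrimeTerm_eq a c z (one_mul 1)),
      tsum_congr (HPrimeTerm_eq a c z (ω := -1) (by norm_num))]
    simp only [one_mul, neg_one_mul]
  · rw [KTilde, ← KPrime_sub_KDoublePrime z hω hω1]
    rw [sin_eq_zetaPow] at hsin ⊢
    rw [hsq] at hω1 ⊢
    generalize zetaPow c (a / 2) = s at *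
    have h1 : 1 - s ^ 2 ≠ 0 := sub_ne_zero.mpr hω1.symm
    -- With `s = ζ_c^(a/2)`, both coefficients `csc/4` and `sin` equal `-i s/2` times the
    -- corresponding coefficients `1/(1-s^2)` and `-(1-s^2)/s^2` of `K'` and `K''`.
    rw [show (s⁻¹ - s) * I / 2 = (1 - s ^ 2) * I / (2 * s) by field_simp]
    have hI := Complex.I_ne_zero
    field_simp
    rw [Complex.I_sq]
    ring
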